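/- Let $T>0$ and $x_0\in[0,1]$. For $u_0\in L^2(0,1)$ and a source $f$, consider the heat equation $$\partial_t u-\partial_{xx}u=f \ \text{ in } (0,T)\times(0,1),\qquad u(\cdot,0)=u(\cdot,1)=0,\qquad u(0,\cdot)=u_0,$$ whose solution $u\in C^0([0,T],L^2(0,1))\cap L^2((0,T),H^1_0(0,1))$ is understood in the weak sense, with test functions in $H^1_0(0,1)$. The datum $u_0$ is called pointwise null-controllable at $x_0$ in time $T$ if there is $\psi\in L^2(0,T)$ such that the solution with source $f(t,\cdot)=\psi(t)\delta_{x_0}$ satisfies $u(T,\cdot)=0$. Let $T_0=T_0(x_0)\in[0,+\infty]$ be the minimal time of pointwise control at $x_0$, i.e. the infimum of the times $T>0$ in which every $u_0\in L^2(0,1)$ is pointwise null-controllable at $x_0$ (with $\inf\emptyset=+\infty$). For $\varepsilon>0$, a null-control of $u_0$ in time $T$ with control domain $(x_0-\varepsilon,x_0+\varepsilon)$ is a function $f\in L^2((0,T)\times(0,1))$ that vanishes almost everywhere outside $(0,T)\times(x_0-\varepsilon,x_0+\varepsilon)$ and for which the solution with source $f$ satisfies $u(T,\cdot)=0$; it is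 optimal if its $L^2((0,T)\times(0,1))$ norm is the smallest among all such null-controls. **Theorem.** Let $0<T\le T_0$, and let $u_0\in L^2(0,1)$ be not pointwise null-controllable at $x_0$ in time $T$. For all small $\varepsilon>0$ let $\psi_\varepsilon$ be the optimal null-control of $u_0$ in time $T$ with control domain $(x_0-\varepsilon,x_0+\varepsilon)$. Then $$\varepsilon^{1/2}\,\|\psi_\varepsilon\|_{L^2((0,T)\times(0,1))}\longrightarrow+\infty\qquad\text{as }\varepsilon\to0^+.$$ -/

import Mathlib

open Set Filter Topology MeasureTheory
open scoped ENNReal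

noncomputable section

namespace HeatControl

/-- The real Hilbert space `L²(0,1)`. -/
abbrev L2 : Type := Lp ℝ 2 (volume.restrict (Ioo (0 : ℝ) 1))

/-- The real Hilbert space `L²(0,T)`. -/
abbrev L2Time (T : ℝ) : Type := Lp ℝ 2 (volume.restrict (Ioo (0 : ℝ) T))

/-- The real Hilbert space `L²((0,T) × (0,1))`; a point is `(t, x)`. -/
abbrev L2Cyl (T : ℝ) : Type :=
  Lp ℝ 2 (volume.restrict (Ioo (0 : ℝ) T ×ˢ Ioo (0 : ℝ) 1))

/-- On `[0,1]`, `φ` is the (absolutely) continuous representative of an element of `H¹₀(0,1)`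
whose weak derivative is `g ∈ L²(0,1)`: it is the primitive of `g` that vanishes at `0`, and it
vanishes at `1`. -/
structure IsH10 (φ : ℝ → ℝ) (g : L2) : Prop where
  eq_integral : ∀ x ∈ Icc (0 : ℝ) 1, φ x = ∫ y in (0 : ℝ)..x, g y
  at_one : φ 1 = 0

/-- `u ∈ C⁰([0,T], L²(0,1)) ∩ L²((0,T), H¹₀(0,1))` is the weak solution on `[0,T]` of
`∂ₜu - ∂ₓₓu = F`, `u(·,0) = u(·,1) = 0`, `u(0,·) = u₀`, where `F s φ` is the duality pairing of
the source at time `s` with a test function `φ ∈ H¹₀(0,1)`.  Here `w` is `∂ₓu`. -/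
structure IsHeatSolution (T : ℝ) (F : ℝ → (ℝ → ℝ) → ℝ) (u₀ : L2) (u : ℝ → L2) : Prop where
  continuousOn : ContinuousOn u (Icc 0 T)
  initial : u 0 = u₀
  weak : ∃ w : ℝ → L2, MemLp w 2 (volume.restrict (Ioo 0 T)) ∧
    (∀ᵐ t ∂(volume.restrict (Ioo 0 T)),
      ∃ v : ℝ → ℝ, IsH10 v (w t) ∧ u t =ᵐ[volume.restrict (Ioo (0 : ℝ) 1)] v) ∧
    ∀ (φ : ℝ → ℝ) (g : L2), IsH10 φ g → ∀ t ∈ Icc 0 T,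
      (∫ x in Ioo (0 : ℝ) 1, u t x * φ x) - (∫ x in Ioo (0 : ℝ) 1, u₀ x * φ x)
        + (∫ s in (0 : ℝ)..t, ∫ x in Ioo (0 : ℝ) 1, w s x * g x)
        = ∫ s in (0 : ℝ)..t, F s φ

/-- The source given by `f ∈ L²((0,T) × (0,1))`. -/
def internalSource {T : ℝ} (f : L2Cyl T) (s : ℝ) (φ : ℝ → ℝ) : ℝ :=
  ∫ x in Ioo (0 : ℝ) 1, f (s, x) * φ x

/-- The source `ψ(t) δ_{x₀}` with `ψ ∈ L²(0,T)`. -/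
def pointSource {T : ℝ} (x₀ : ℝ) (ψ : L2Time T) (s : ℝ) (φ : ℝ → ℝ) : ℝ :=
  ψ s * φ x₀

/-- `f` is a null-control of `u₀` in time `T` with control domain `(x₀ - ε, x₀ + ε)`. -/
def IsNullControl (x₀ ε T : ℝ) (u₀ : L2) (f : L2Cyl T) : Prop :=
  (∀ᵐ p ∂(volume.restrict (Ioo (0 : ℝ) T ×ˢ Ioo (0 : ℝ) 1)),
    p.2 ∉ Ioo (x₀ - ε) (x₀ + ε) → f p = 0) ∧
  ∃ u : ℝ → L2, IsHeatSolution T (internalSource f) u₀ u ∧ u T = 0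

/-- `f` is a null-control of smallest `L²` norm. -/
def IsOptimalNullControl (x₀ ε T : ℝ) (u₀ : L2) (f : L2Cyl T) : Prop :=
  IsNullControl x₀ ε T u₀ f ∧ ∀ h : L2Cyl T, IsNullControl x₀ ε T u₀ h → ‖f‖ ≤ ‖h‖

/-- `u₀` is pointwise null-controllable at `x₀` in time `T`. -/
def IsPointwiseNullControllable (x₀ T : ℝ) (u₀ : L2) : Prop :=
  ∃ ψ : L2Time T, ∃ u : ℝ → L2, IsHeatSolution T (pointSource x₀ ψ) u₀ u ∧ u T = 0

/-- The minimal time `T₀ ∈ [0,∞]` of pointwise control at `x₀`: the infimum of the times `T > 0`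
in which every initial datum is pointwise null-controllable at `x₀` (`∞` if there is none). -/
def minimalTime (x₀ : ℝ) : ℝ≥0∞ :=
  sInf {τ : ℝ≥0∞ | ∃ T : ℝ, 0 < T ∧ τ = ENNReal.ofReal T ∧
    ∀ u₀ : L2, IsPointwiseNullControllable x₀ T u₀}

end HeatControl

end

/-! The argument is by contradiction and compactness. Suppose `√ε * ‖ψ ε‖` stays bounded along an
ultrafilter `U` finer than `𝓝[>] 0`. Integrating a control in space gives the functional `h ↦ ∬
f(t,x) h(t)` on `L²(0,T)`. Since `f` lives in a strip of width `2ε`, Cauchy-Schwarz bounds this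
functional by `√(2ε) ‖f‖` (`norm_timeFunctional_le`), which is bounded along `U`. Banach-Alaoglu and
Riesz then give a weak limit in `L²(0,T)`, the candidate pointwise control.

Null-control is a moment problem. With `λ_k = freq k ^ 2` and `s_k = sinMode k`, testing the weak
equation with `s_k` and solving a scalar equation shows that a null-control satisfies `⟨s_k, u₀⟩ + ∬
f exp(λ_k t) s_k(x) = 0` (`IsNullControl.moment`). Replacing `s_k(x)` by `s_k(x₀)` costs a Lipschitz
factor `O(ε)` on top of the bounded quantity `√(2ε) ‖f‖` (`IsNullControl.abs_moment_le`). For each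
fixed `k` the limit therefore satisfies the moment equation of the source `ψ(t) δ_{x₀}`.

It remains to pass from moments back to a solution (`isHeatSolution_pointSolution`). The state is a
sine series with Duhamel coefficients and its space derivative a cosine series. Both converge by a
modal energy estimate, because `s_k(x₀)² ≤ 2` and `∑ 1/λ_k < ∞`. -/

noncomputable section

namespace HeatControl

/-! ### Calculus of primitives -/

/-- Product rule for two functions which are primitives of integrable functions. -/
theorem integral_mul_add_mul_of_primitive {f g F G : ℝ → ℝ} {a b : ℝ}
    (hf : IntervalIntegrable f volume a b) (hg : IntervalIntegrable g volume a b)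
    (hF : ∀ x ∈ uIcc a b, F x = F a + ∫ y in a..x, f y)
    (hG : ∀ x ∈ uIcc a b, G x = G a + ∫ y in a..x, g y) :
    ∫ x in a..b, (f x * G x + F x * g x) = F b * G b - F a * G a := by
  have acF := (hf.absolutelyContinuousOnInterval_intervalIntegral (c := a) (by simp))
  have acG := (hg.absolutelyContinuousOnInterval_intervalIntegral (c := a) (by simp))
  have key := acF.integral_deriv_mul_eq_sub acG
  have hint1 : IntervalIntegrable (fun x => f x * ∫ y in a..x, g y) volume a b :=
    hf.mul_continuousOn acG.continuousOn
  have hint2 : IntervalIntegrable (fun x => (∫ y in a..x, f y) * g x) volume a b :=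
    hg.continuousOn_mul acF.continuousOn
  have e1 : ∫ x in a..b, (f x * G x + F x * g x) =
      ∫ x in a..b, ((f x * G a + F a * g x) +
        (f x * (∫ y in a..x, g y) + (∫ y in a..x, f y) * g x)) := by
    refine intervalIntegral.integral_congr fun x hx => ?_
    simp only [hF x hx, hG x hx]; ring
  have e2 : ∫ x in a..b, (f x * (∫ y in a..x, g y) + (∫ y in a..x, f y) * g x) =
      (∫ y in a..b, f y) * (∫ y in a..b, g y) := by
    rw [intervalIntegral.integral_same, intervalIntegral.integral_same] at key
    rw [← sub_zero ((∫ y in a..b, f y) * _), ← zero_mul (0 : ℝ), ← key]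
    refine intervalIntegral.integral_congr_ae ?_
    filter_upwards [hf.ae_hasDerivAt_integral, hg.ae_hasDerivAt_integral] with x h1 h2 hx
    rw [(h1 (uIoc_subset_uIcc hx) a (by simp)).deriv, (h2 (uIoc_subset_uIcc hx) a (by simp)).deriv]
  rw [e1, intervalIntegral.integral_add ((hf.mul_const _).add (hg.const_mul _))
    (hint1.add hint2), e2, intervalIntegral.integral_add (hf.mul_const _) (hg.const_mul _),
    intervalIntegral.integral_mul_const, intervalIntegral.integral_const_mul,
    hF b (by simp), hG b (by simp)]
  ring

theorem eq_add_integral_of_hasDerivAt {F f : ℝ → ℝ} (hF : ∀ x, HasDerivAt F (f x) x)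
    (hf : Continuous f) (a x : ℝ) : F x = F a + ∫ y in a..x, f y := by
  rw [intervalIntegral.integral_eq_sub_of_hasDerivAt (fun y _ => hF y)
    (hf.intervalIntegrable _ _)]
  ring

/-! ### The scalar equation `y' + l y = p` -/

/-- The solution of `y' + l y = p`, `y 0 = α`. -/
def duhamel (l α : ℝ) (p : ℝ → ℝ) (t : ℝ) : ℝ :=
  Real.exp (-(l * t)) * (α + ∫ s in (0 : ℝ)..t, Real.exp (l * s) * p s)

section duhamel

variable {l α T : ℝ} {p : ℝ → ℝ}

theorem hasDerivAt_exp_mul (l x : ℝ) :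
    HasDerivAt (fun t => Real.exp (l * t)) (l * Real.exp (l * x)) x := by
  have := ((hasDerivAt_id x).const_mul l).exp
  simpa [mul_comm] using this

theorem intervalIntegrable_exp_mul (hp : IntervalIntegrable p volume 0 T) :
    IntervalIntegrable (fun s => Real.exp (l * s) * p s) volume 0 T :=
  hp.continuousOn_mul (by fun_prop)

theorem continuousOn_duhamel (hT : 0 ≤ T) (hp : IntervalIntegrable p volume 0 T) :
    ContinuousOn (duhamel l α p) (Icc 0 T) := by
  have h := ((intervalIntegrable_exp_mul (l := l)
    hp).absolutelyContinuousOnInterval_intervalIntegral (c := 0) (by simp)).continuousOn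
  rw [uIcc_of_le hT] at h
  exact ContinuousOn.mul (by fun_prop) (continuousOn_const.add h)

@[simp] theorem duhamel_zero : duhamel l α p 0 = α := by simp [duhamel]

/-- The equation is kept in integrated form because `p` is only integrable. The proof is the product
rule for `exp (-l t)` and the primitive in Duhamel's formula. -/
theorem duhamel_integral_eq (hp : IntervalIntegrable p volume 0 T) {t : ℝ}
    (ht : t ∈ Icc 0 T) :
    duhamel l α p t - α + l * ∫ s in (0 : ℝ)..t, duhamel l α p s = ∫ s in (0 : ℝ)..t, p s := by
  have hp' : IntervalIntegrable p volume 0 t :=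
    hp.mono_set (uIcc_subset_uIcc (by simp) (by rw [uIcc_of_le (ht.1.trans ht.2)]; exact ht))
  have hy : IntervalIntegrable (duhamel l α p) volume 0 t :=
    ContinuousOn.intervalIntegrable (by
      rw [uIcc_of_le ht.1]; exact continuousOn_duhamel ht.1 hp')
  have key := integral_mul_add_mul_of_primitive (a := 0) (b := t)
    (F := fun t => Real.exp (-l * t)) (f := fun t => -l * Real.exp (-l * t))
    (G := fun t => α + ∫ s in (0 : ℝ)..t, Real.exp (l * s) * p s)
    (g := fun s => Real.exp (l * s) * p s)
    (Continuous.intervalIntegrable (by fun_prop) _ _) (intervalIntegrable_exp_mul hp')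
    (fun x _ => eq_add_integral_of_hasDerivAt (fun x => hasDerivAt_exp_mul _ x)
      (by fun_prop) _ _) (fun x _ => by simp)
  have e : ∀ s, -l * Real.exp (-l * s) * (α + ∫ r in (0 : ℝ)..s, Real.exp (l * r) * p r)
      + Real.exp (-l * s) * (Real.exp (l * s) * p s) = p s - l * duhamel l α p s := by
    intro s
    rw [← mul_assoc (Real.exp _), ← Real.exp_add, duhamel]
    simp only [neg_mul, neg_add_cancel, Real.exp_zero]; ring
  simp only [e] at key
  rw [intervalIntegral.integral_sub hp' (hy.const_mul l), intervalIntegral.integral_const_mul]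
    at key
  simp only [mul_zero, Real.exp_zero, intervalIntegral.integral_same, one_mul, add_zero] at key
  have : duhamel l α p t = Real.exp (-l * t) * (α + ∫ s in (0 : ℝ)..t, Real.exp (l * s) * p s) := by
    simp [duhamel]
  rw [this]; linarith

/-- Uniqueness by the integrating factor: `exp (l t) y` has derivative `exp (l t) p`. -/
theorem eq_duhamel_of_integral_eq (hT : 0 ≤ T) (hp : IntervalIntegrable p volume 0 T) {y : ℝ → ℝ}
    (hy : ContinuousOn y (Icc 0 T))
    (h : ∀ t ∈ Icc 0 T, y t - α + l * ∫ s in (0 : ℝ)..t, y s = ∫ s in (0 : ℝ)..t, p s) :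
    y T = duhamel l α p T := by
  have hyi : IntervalIntegrable y volume 0 T :=
    ContinuousOn.intervalIntegrable (by rwa [uIcc_of_le hT])
  have h0 : y 0 = α := by
    have := h 0 (by simp [hT]); simp at this; linarith
  have key := integral_mul_add_mul_of_primitive (a := 0) (b := T)
    (F := fun t => Real.exp (l * t)) (f := fun t => l * Real.exp (l * t))
    (G := y) (g := fun s => p s - l * y s)
    (Continuous.intervalIntegrable (by fun_prop) _ _) (hp.sub (hyi.const_mul l))
    (fun x _ => eq_add_integral_of_hasDerivAt (fun x => hasDerivAt_exp_mul _ x)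
      (by fun_prop) _ _) (fun x hx => by
        have hs : uIcc 0 x ⊆ uIcc 0 T := uIcc_subset_uIcc (by simp) hx
        rw [intervalIntegral.integral_sub (hp.mono_set hs) ((hyi.mono_set hs).const_mul l),
          intervalIntegral.integral_const_mul, h0]
        rw [uIcc_of_le hT] at hx
        linarith [h x hx])
  have e : ∀ s, l * Real.exp (l * s) * y s + Real.exp (l * s) * (p s - l * y s) =
    Real.exp (l * s) * p s := fun s => by ring
  simp only [e, h0, mul_zero, Real.exp_zero, one_mul] at key
  rw [duhamel, key, add_sub_cancel, ← mul_assoc, ← Real.exp_add]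
  simp

theorem duhamel_energy (hp : IntervalIntegrable p volume 0 T) {t : ℝ} (ht : t ∈ Icc 0 T) :
    duhamel l α p t ^ 2 + 2 * l * ∫ s in (0 : ℝ)..t, duhamel l α p s ^ 2 =
      α ^ 2 + 2 * ∫ s in (0 : ℝ)..t, p s * duhamel l α p s := by
  have hp' : IntervalIntegrable p volume 0 t :=
    hp.mono_set (uIcc_subset_uIcc (by simp) (by rw [uIcc_of_le (ht.1.trans ht.2)]; exact ht))
  have hc : ContinuousOn (duhamel l α p) (uIcc 0 t) := by
    rw [uIcc_of_le ht.1]; exact continuousOn_duhamel ht.1 hp'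
  have hy : IntervalIntegrable (duhamel l α p) volume 0 t := hc.intervalIntegrable
  have hprim : ∀ x ∈ uIcc 0 t, duhamel l α p x = duhamel l α p 0 +
      ∫ s in (0 : ℝ)..x, (p s - l * duhamel l α p s) := by
    intro x hx
    have hs : uIcc 0 x ⊆ uIcc 0 t := uIcc_subset_uIcc (by simp) hx
    rw [intervalIntegral.integral_sub (hp'.mono_set hs) ((hy.mono_set hs).const_mul l),
      intervalIntegral.integral_const_mul, duhamel_zero]
    rw [uIcc_of_le ht.1] at hx
    linarith [duhamel_integral_eq (l := l) (α := α) hp' hx]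
  have hc2 : IntervalIntegrable (fun s => duhamel l α p s ^ 2) volume 0 t :=
    (hc.pow 2).intervalIntegrable
  have key := integral_mul_add_mul_of_primitive (hp'.sub (hy.const_mul l))
    (hp'.sub (hy.const_mul l)) hprim hprim
  have e : ∀ s, (p s - l * duhamel l α p s) * duhamel l α p s +
      duhamel l α p s * (p s - l * duhamel l α p s) =
      2 * (p s * duhamel l α p s) - 2 * l * duhamel l α p s ^ 2 := fun s => by ring
  simp only [e] at key
  rw [intervalIntegral.integral_sub ((hp'.mul_continuousOn hc).const_mul 2)
    (hc2.const_mul _), intervalIntegral.integral_const_mul,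
    intervalIntegral.integral_const_mul, duhamel_zero] at key
  linarith

/-- Young's inequality `2 p y ≤ p² / l + l y²` spends half of the dissipation. The gain `1 / l` on
the source is what makes the sum over modes converge for a Dirac mass. -/
theorem duhamel_energy_le (hl : 0 < l) (hp : IntervalIntegrable p volume 0 T)
    (hp2 : IntervalIntegrable (fun s => p s ^ 2) volume 0 T) {t : ℝ} (ht : t ∈ Icc 0 T) :
    duhamel l α p t ^ 2 + l * (∫ s in (0 : ℝ)..t, duhamel l α p s ^ 2) ≤
      α ^ 2 + (∫ s in (0 : ℝ)..T, p s ^ 2) / l := by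
  have hsub : uIcc 0 t ⊆ uIcc 0 T :=
    uIcc_subset_uIcc (by simp) (by rw [uIcc_of_le (ht.1.trans ht.2)]; exact ht)
  have hp' := hp.mono_set hsub
  have hp2' := hp2.mono_set hsub
  have hc : ContinuousOn (duhamel l α p) (uIcc 0 t) := by
    rw [uIcc_of_le ht.1]; exact continuousOn_duhamel ht.1 hp'
  have hc2 : IntervalIntegrable (fun s => duhamel l α p s ^ 2) volume 0 t :=
    (hc.pow 2).intervalIntegrable
  have h1 : 2 * ∫ s in (0 : ℝ)..t, p s * duhamel l α p s ≤
      (∫ s in (0 : ℝ)..t, p s ^ 2) / l + l * ∫ s in (0 : ℝ)..t, duhamel l α p s ^ 2 := by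
    rw [← intervalIntegral.integral_const_mul, ← intervalIntegral.integral_div,
      ← intervalIntegral.integral_const_mul, ← intervalIntegral.integral_add (hp2'.div_const _)
        (hc2.const_mul _)]
    refine intervalIntegral.integral_mono_on ht.1 ((hp'.mul_continuousOn hc).const_mul 2)
      ((hp2'.div_const _).add (hc2.const_mul _)) fun s _ => ?_
    have : p s ^ 2 / l + l * duhamel l α p s ^ 2 - 2 * (p s * duhamel l α p s) =
        (p s - l * duhamel l α p s) ^ 2 / l := by field_simp; ring
    have h0 : 0 ≤ (p s - l * duhamel l α p s) ^ 2 / l := by positivity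
    linarith
  have h2 : (∫ s in (0 : ℝ)..t, p s ^ 2) / l ≤ (∫ s in (0 : ℝ)..T, p s ^ 2) / l := by
    gcongr
    exact intervalIntegral.integral_mono_interval le_rfl ht.1 ht.2
      (Eventually.of_forall fun _ => sq_nonneg _) hp2
  linarith [duhamel_energy (l := l) (α := α) hp ht]

end duhamel

/-! ### Completeness of the cosines and the sines on `(0,1)` -/

theorem integrable_mul_of_continuous {h : ℝ → ℝ} {a b : ℝ}
    (hh : Integrable h (volume.restrict (Ioo a b))) {φ : ℝ → ℝ} (hφ : Continuous φ) :
    Integrable (fun x => h x * φ x) (volume.restrict (Ioo a b)) := by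
  obtain ⟨C, hC⟩ := isCompact_Icc.exists_bound_of_continuousOn (hφ.continuousOn (s := Icc a b))
  refine hh.mul_bdd (c := C) hφ.aestronglyMeasurable ?_
  filter_upwards [ae_restrict_mem measurableSet_Ioo] with x hx
  exact hC x (Ioo_subset_Icc_self hx)

/-- Multiplication by `cos (π x)` averages the frequencies `m + 1` and `m - 1`. Taking `m` in `ℤ`
keeps the induction free of a boundary case. -/
theorem integral_mul_cos_pow_mul_cos_eq_zero {h : ℝ → ℝ}
    (hh : Integrable h (volume.restrict (Ioo 0 1)))
    (h0 : ∀ n : ℕ, ∫ x in Ioo (0 : ℝ) 1, h x * Real.cos (n * Real.pi * x) = 0) (n : ℕ) :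
    ∀ m : ℤ, ∫ x in Ioo (0 : ℝ) 1,
      h x * (Real.cos (Real.pi * x) ^ n * Real.cos (m * Real.pi * x)) = 0 := by
  induction n with
  | zero =>
    intro m
    refine Eq.trans ?_ (h0 m.natAbs)
    congr 1
    funext x
    simp only [pow_zero, one_mul]
    congr 1
    rcases Int.natAbs_eq m with hm | hm
    · conv_lhs => rw [hm]
      simp
    · conv_lhs => rw [hm]
      simp
  | succ n ih =>
    intro m
    have e : ∀ x, h x * (Real.cos (Real.pi * x) ^ (n + 1) * Real.cos (m * Real.pi * x)) =
        2⁻¹ * (h x * (Real.cos (Real.pi * x) ^ n * Real.cos ((m + 1 : ℤ) * Real.pi * x))) +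
        2⁻¹ * (h x * (Real.cos (Real.pi * x) ^ n * Real.cos ((m - 1 : ℤ) * Real.pi * x))) := by
      intro x
      have e1 : ((m + 1 : ℤ) : ℝ) * Real.pi * x = m * Real.pi * x + Real.pi * x := by
        push_cast; ring
      have e2 : ((m - 1 : ℤ) : ℝ) * Real.pi * x = m * Real.pi * x - Real.pi * x := by
        push_cast; ring
      rw [e1, e2, Real.cos_add, Real.cos_sub]
      ring
    simp only [e]
    rw [integral_add, integral_const_mul, integral_const_mul, ih, ih]
    · simp
    · exact (integrable_mul_of_continuous hh (by fun_prop)).const_mul _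
    · exact (integrable_mul_of_continuous hh (by fun_prop)).const_mul _

theorem integral_mul_polynomial_cos_eq_zero {h : ℝ → ℝ}
    (hh : Integrable h (volume.restrict (Ioo 0 1)))
    (h0 : ∀ n : ℕ, ∫ x in Ioo (0 : ℝ) 1, h x * Real.cos (n * Real.pi * x) = 0)
    (q : Polynomial ℝ) : ∫ x in Ioo (0 : ℝ) 1, h x * q.eval (Real.cos (Real.pi * x)) = 0 := by
  induction q using Polynomial.induction_on' with
  | add p q hp hq =>
    simp only [Polynomial.eval_add, mul_add]
    rw [integral_add, hp, hq, add_zero]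
    · exact integrable_mul_of_continuous hh (p.continuous.comp (by fun_prop))
    · exact integrable_mul_of_continuous hh (q.continuous.comp (by fun_prop))
  | monomial n a =>
    have := integral_mul_cos_pow_mul_cos_eq_zero hh h0 n 0
    simp only [Int.cast_zero, zero_mul, Real.cos_zero, mul_one] at this
    simp only [Polynomial.eval_monomial, mul_left_comm _ a]
    rw [integral_const_mul, this, mul_zero]

/-- On `[0,1]` a continuous `φ` is a continuous function of `y = cos (π x)`, namely `φ (arccos y /
π)`, so Weierstrass approximates it by polynomials in the cosine. -/
theorem ae_eq_zero_of_integral_mul_cos_eq_zero {h : ℝ → ℝ}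
    (hh : Integrable h (volume.restrict (Ioo 0 1)))
    (h0 : ∀ n : ℕ, ∫ x in Ioo (0 : ℝ) 1, h x * Real.cos (n * Real.pi * x) = 0) :
    ∀ᵐ x ∂(volume.restrict (Ioo (0 : ℝ) 1)), h x = 0 := by
  refine ae_eq_zero_of_integral_contDiff_smul_eq_zero hh.locallyIntegrable fun φ hφ _ => ?_
  have hφc := hφ.continuous
  simp only [smul_eq_mul, mul_comm (φ _)]
  rw [← abs_nonpos_iff]
  refine le_of_forall_pos_le_add fun ε hε => ?_
  set I := ∫ x in Ioo (0 : ℝ) 1, |h x| with hI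
  have hI0 : 0 ≤ I := integral_nonneg fun _ => abs_nonneg _
  obtain ⟨q, hq⟩ := exists_polynomial_near_of_continuousOn (-1) 1
    (fun y => φ (Real.arccos y / Real.pi))
    ((hφc.comp (Real.continuous_arccos.div_const _)).continuousOn) (ε / (I + 1)) (by positivity)
  have hqc : Continuous fun x : ℝ => q.eval (Real.cos (Real.pi * x)) :=
    q.continuous.comp (by fun_prop)
  have hsub : ∫ x in Ioo (0 : ℝ) 1, h x * φ x = (∫ x in Ioo (0 : ℝ) 1, h x * φ x) -
      ∫ x in Ioo (0 : ℝ) 1, h x * q.eval (Real.cos (Real.pi * x)) := by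
    rw [integral_mul_polynomial_cos_eq_zero hh h0 q, sub_zero]
  rw [hsub, ← integral_sub (integrable_mul_of_continuous hh hφc) (integrable_mul_of_continuous hh hqc)]
  calc |∫ x in Ioo (0 : ℝ) 1, (h x * φ x - h x * q.eval (Real.cos (Real.pi * x)))|
      ≤ ∫ x in Ioo (0 : ℝ) 1, |h x| * (ε / (I + 1)) := by
        rw [← Real.norm_eq_abs]
        refine norm_integral_le_of_norm_le (hh.abs.mul_const _) ?_
        filter_upwards [ae_restrict_mem measurableSet_Ioo] with x hx
        rw [← mul_sub, Real.norm_eq_abs, abs_mul, abs_sub_comm]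
        have := hq (Real.cos (Real.pi * x)) ⟨Real.neg_one_le_cos _, Real.cos_le_one _⟩
        rw [Real.arccos_cos (by have := hx.1; positivity)
          (by have := hx.2; nlinarith [Real.pi_pos]),
          mul_div_cancel_left₀ _ Real.pi_ne_zero] at this
        gcongr
    _ = I * (ε / (I + 1)) := by rw [integral_mul_const]
    _ ≤ 0 + ε := by
        rw [zero_add, mul_div_assoc', div_le_iff₀ (by positivity)]
        nlinarith

/-- Reduction to cosines: `sin (π x) cos (n π x)` is a combination of sines, so `h sin (π x)`
vanishes a.e., and `sin (π x) > 0` on `(0,1)`. -/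
theorem ae_eq_zero_of_integral_mul_sin_eq_zero {h : ℝ → ℝ}
    (hh : Integrable h (volume.restrict (Ioo 0 1)))
    (h0 : ∀ n : ℕ, ∫ x in Ioo (0 : ℝ) 1, h x * Real.sin ((n + 1) * Real.pi * x) = 0) :
    ∀ᵐ x ∂(volume.restrict (Ioo (0 : ℝ) 1)), h x = 0 := by
  have h0' : ∀ n : ℕ, ∫ x in Ioo (0 : ℝ) 1, h x * Real.sin (n * Real.pi * x) = 0 := by
    intro n
    cases n with
    | zero => simp
    | succ n => simpa using h0 n
  have key := ae_eq_zero_of_integral_mul_cos_eq_zero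
    (integrable_mul_of_continuous hh (φ := fun x => Real.sin (Real.pi * x)) (by fun_prop)) ?_
  · filter_upwards [key, ae_restrict_mem measurableSet_Ioo] with x hx hx1
    have : 0 < Real.sin (Real.pi * x) := Real.sin_pos_of_pos_of_lt_pi
      (by have := hx1.1; positivity) (by have := hx1.2; nlinarith [Real.pi_pos])
    exact (mul_eq_zero.1 hx).resolve_right this.ne'
  · intro n
    cases n with
    | zero => simpa using h0 0
    | succ n =>
      have e : ∀ x, h x * Real.sin (Real.pi * x) * Real.cos ((n + 1 : ℕ) * Real.pi * x) =
          2⁻¹ * (h x * Real.sin (((n + 1 : ℕ) + 1) * Real.pi * x)) -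
          2⁻¹ * (h x * Real.sin (n * Real.pi * x)) := by
        intro x
        have e1 : (((n + 1 : ℕ) : ℝ) + 1) * Real.pi * x =
          (n + 1 : ℕ) * Real.pi * x + Real.pi * x := by ring
        have e2 : (n : ℝ) * Real.pi * x = (n + 1 : ℕ) * Real.pi * x - Real.pi * x := by
          push_cast; ring
        rw [e1, e2, Real.sin_add, Real.sin_sub]
        ring
      simp only [e]
      rw [integral_sub, integral_const_mul, integral_const_mul, h0, h0']
      · simp
      · exact (integrable_mul_of_continuous hh (by fun_prop)).const_mul _
      · exact (integrable_mul_of_continuous hh (by fun_prop)).const_mul _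

/-! ### Hilbert bases of `L²(0,1)` -/

theorem memLp_of_continuousOn {φ : ℝ → ℝ} {a b : ℝ} (hφ : ContinuousOn φ (Icc a b)) (p : ℝ≥0∞) :
    MemLp φ p (volume.restrict (Ioo a b)) := by
  obtain ⟨C, hC⟩ := isCompact_Icc.exists_bound_of_continuousOn hφ
  refine MemLp.of_bound ((hφ.mono Ioo_subset_Icc_self).aestronglyMeasurable measurableSet_Ioo) C ?_
  filter_upwards [ae_restrict_mem measurableSet_Ioo] with x hx
  exact hC x (Ioo_subset_Icc_self hx)

/-- The class in `L²(0,1)` of a continuous function. -/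
def toL2 (φ : ℝ → ℝ) (hφ : Continuous φ) : L2 := (memLp_of_continuousOn hφ.continuousOn 2).toLp φ

theorem coeFn_toL2 {φ : ℝ → ℝ} (hφ : Continuous φ) :
    toL2 φ hφ =ᵐ[volume.restrict (Ioo (0 : ℝ) 1)] φ := MemLp.coeFn_toLp _

theorem inner_eq_integral {α : Type*} [MeasurableSpace α] {μ : Measure α} (f g : Lp ℝ 2 μ) :
    inner ℝ f g = ∫ x, f x * g x ∂μ := by
  rw [L2.inner_def]
  simp [mul_comm]

theorem inner_toL2 {φ : ℝ → ℝ} (hφ : Continuous φ) (g : L2) :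
    inner ℝ (toL2 φ hφ) g = ∫ x in Ioo (0 : ℝ) 1, g x * φ x := by
  rw [inner_eq_integral]
  refine integral_congr_ae ?_
  filter_upwards [coeFn_toL2 hφ] with x hx
  rw [hx, mul_comm]

theorem inner_toL2_toL2 {φ χ : ℝ → ℝ} (hφ : Continuous φ) (hχ : Continuous χ) :
    inner ℝ (toL2 φ hφ) (toL2 χ hχ) = ∫ x in (0 : ℝ)..1, φ x * χ x := by
  rw [inner_toL2, intervalIntegral.integral_of_le zero_le_one, integral_Ioc_eq_integral_Ioo]
  refine integral_congr_ae ?_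
  filter_upwards [coeFn_toL2 hχ] with x hx
  rw [hx, mul_comm]

theorem integrable_coeFn (g : L2) : Integrable g (volume.restrict (Ioo (0 : ℝ) 1)) :=
  (Lp.memLp g).integrable (by norm_num)

/-- The wave number `(k + 1) π`. -/
def freq (k : ℕ) : ℝ := (k + 1) * Real.pi

theorem freq_pos (k : ℕ) : 0 < freq k := by unfold freq; positivity

/-- The normalized sine modes. -/
def sinMode (k : ℕ) (x : ℝ) : ℝ := √2 * Real.sin (freq k * x)

/-- The normalized cosine modes, the constant mode being excluded. -/
def cosMode (k : ℕ) (x : ℝ) : ℝ := √2 * Real.cos (freq k * x)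

@[fun_prop] theorem continuous_sinMode (k : ℕ) : Continuous (sinMode k) := by
  unfold sinMode; fun_prop

@[fun_prop] theorem continuous_cosMode (k : ℕ) : Continuous (cosMode k) := by
  unfold cosMode; fun_prop

theorem hasDerivAt_sinMode (k : ℕ) (x : ℝ) :
    HasDerivAt (sinMode k) (freq k * cosMode k x) x := by
  have := (((hasDerivAt_id x).const_mul (freq k)).sin).const_mul √2
  refine this.congr_deriv ?_
  simp [cosMode]; ring

theorem hasDerivAt_cosMode (k : ℕ) (x : ℝ) :
    HasDerivAt (cosMode k) (-(freq k * sinMode k x)) x := by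
  have := (((hasDerivAt_id x).const_mul (freq k)).cos).const_mul √2
  refine this.congr_deriv ?_
  simp [sinMode]; ring

@[simp] theorem sinMode_zero (k : ℕ) : sinMode k 0 = 0 := by simp [sinMode]

@[simp] theorem sinMode_one (k : ℕ) : sinMode k 1 = 0 := by
  have := Real.sin_nat_mul_pi (k + 1)
  push_cast at this
  simp [sinMode, freq, this]

theorem abs_sinMode_le (k : ℕ) (x : ℝ) : |sinMode k x| ≤ √2 := by
  rw [sinMode, abs_mul, abs_of_nonneg (Real.sqrt_nonneg _)]
  exact mul_le_of_le_one_right (Real.sqrt_nonneg _) (Real.abs_sin_le_one _)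

theorem integral_cos_int (m : ℤ) :
    ∫ x in (0 : ℝ)..1, Real.cos (m * Real.pi * x) = if m = 0 then 1 else 0 := by
  split_ifs with h
  · simp [h]
  · have hm : (m : ℝ) * Real.pi ≠ 0 := by
      have : (m : ℝ) ≠ 0 := by exact_mod_cast h
      positivity
    rw [intervalIntegral.integral_comp_mul_left _ hm]
    simp [Real.sin_int_mul_pi]

/-- The sine modes as elements of `L²(0,1)`. -/
def sinVec (k : ℕ) : L2 := toL2 (sinMode k) (by fun_prop)

/-- The cosine modes, starting with the constant one, as elements of `L²(0,1)`. -/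
def cosVec : ℕ → L2
  | 0 => toL2 (fun _ => 1) (by fun_prop)
  | k + 1 => toL2 (cosMode k) (by fun_prop)

theorem integral_sinMode_mul_sinMode (j k : ℕ) :
    ∫ x in (0 : ℝ)..1, sinMode j x * sinMode k x = if j = k then 1 else 0 := by
  have e : ∀ x, sinMode j x * sinMode k x = Real.cos (((j - k : ℤ) : ℝ) * Real.pi * x) -
      Real.cos (((j + k + 2 : ℤ) : ℝ) * Real.pi * x) := by
    intro x
    have e1 : ((j - k : ℤ) : ℝ) * Real.pi * x = freq j * x - freq k * x := by
      simp [freq]; ring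
    have e2 : ((j + k + 2 : ℤ) : ℝ) * Real.pi * x = freq j * x + freq k * x := by
      simp [freq]; ring
    rw [e1, e2, Real.cos_add, Real.cos_sub, sinMode, sinMode]
    linear_combination Real.sin (freq j * x) * Real.sin (freq k * x) *
      Real.mul_self_sqrt (zero_le_two (α := ℝ))
  simp only [e]
  rw [intervalIntegral.integral_sub (Continuous.intervalIntegrable (by fun_prop) _ _)
    (Continuous.intervalIntegrable (by fun_prop) _ _), integral_cos_int, integral_cos_int,
    if_neg (by omega : ¬ ((j : ℤ) + k + 2 = 0)), sub_zero]
  exact if_congr (by omega) rfl rfl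

theorem integral_cosMode_mul_cosMode (j k : ℕ) :
    ∫ x in (0 : ℝ)..1, cosMode j x * cosMode k x = if j = k then 1 else 0 := by
  have e : ∀ x, cosMode j x * cosMode k x = Real.cos (((j - k : ℤ) : ℝ) * Real.pi * x) +
      Real.cos (((j + k + 2 : ℤ) : ℝ) * Real.pi * x) := by
    intro x
    have e1 : ((j - k : ℤ) : ℝ) * Real.pi * x = freq j * x - freq k * x := by
      simp [freq]; ring
    have e2 : ((j + k + 2 : ℤ) : ℝ) * Real.pi * x = freq j * x + freq k * x := by
      simp [freq]; ring
    rw [e1, e2, Real.cos_add, Real.cos_sub, cosMode, cosMode]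
    linear_combination Real.cos (freq j * x) * Real.cos (freq k * x) *
      Real.mul_self_sqrt (zero_le_two (α := ℝ))
  simp only [e]
  rw [intervalIntegral.integral_add (Continuous.intervalIntegrable (by fun_prop) _ _)
    (Continuous.intervalIntegrable (by fun_prop) _ _), integral_cos_int, integral_cos_int,
    if_neg (by omega : ¬ ((j : ℤ) + k + 2 = 0)), add_zero]
  exact if_congr (by omega) rfl rfl

theorem integral_cosMode (k : ℕ) (x : ℝ) :
    ∫ y in (0 : ℝ)..x, cosMode k y = sinMode k x / freq k := by
  have := eq_add_integral_of_hasDerivAt (hasDerivAt_sinMode k) (by fun_prop) 0 x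
  rw [intervalIntegral.integral_const_mul, sinMode_zero, zero_add] at this
  rw [this, mul_div_cancel_left₀ _ (freq_pos k).ne']

theorem orthonormal_sinVec : Orthonormal ℝ sinVec := by
  rw [orthonormal_iff_ite]
  intro j k
  rw [sinVec, sinVec, inner_toL2_toL2, integral_sinMode_mul_sinMode]

theorem orthonormal_cosVec : Orthonormal ℝ cosVec := by
  rw [orthonormal_iff_ite]
  rintro (_ | j) (_ | k)
  · rw [cosVec, inner_toL2_toL2]; simp
  · simp [cosVec, inner_toL2_toL2, integral_cosMode]
  · simp [cosVec, inner_toL2_toL2, integral_cosMode]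
  · simp [cosVec, inner_toL2_toL2, integral_cosMode_mul_cosMode]

theorem eq_zero_of_inner_sinVec_eq_zero {f : L2} (h : ∀ k, inner ℝ (sinVec k) f = 0) : f = 0 := by
  rw [Lp.eq_zero_iff_ae_eq_zero]
  refine ae_eq_zero_of_integral_mul_sin_eq_zero (integrable_coeFn f) fun n => ?_
  have := h n
  rw [sinVec, inner_toL2] at this
  simp only [sinMode, freq, mul_left_comm _ √2] at this
  rw [integral_const_mul] at this
  exact (mul_eq_zero.1 this).resolve_left (by positivity)

theorem eq_zero_of_inner_cosVec_eq_zero {f : L2} (h : ∀ k, inner ℝ (cosVec k) f = 0) : f = 0 := by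
  rw [Lp.eq_zero_iff_ae_eq_zero]
  refine ae_eq_zero_of_integral_mul_cos_eq_zero (integrable_coeFn f) fun n => ?_
  have := h n
  cases n with
  | zero => simpa [cosVec, inner_toL2] using this
  | succ n =>
    rw [cosVec, inner_toL2] at this
    simp only [cosMode, freq, mul_left_comm _ √2] at this
    rw [integral_const_mul] at this
    simpa using (mul_eq_zero.1 this).resolve_left (by positivity)

theorem orthogonal_span_range_eq_bot {E : Type*} [NormedAddCommGroup E] [InnerProductSpace ℝ E]
    {v : ℕ → E} (h : ∀ f, (∀ k, inner ℝ (v k) f = 0) → f = 0) :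
    (Submodule.span ℝ (range v))ᗮ = ⊥ := by
  rw [eq_bot_iff]
  intro f hf
  exact h f fun k => (Submodule.mem_orthogonal _ _).1 hf _ (Submodule.subset_span ⟨k, rfl⟩)

/-- The Hilbert basis of sines. -/
def sinBasis : HilbertBasis ℕ ℝ L2 := HilbertBasis.mkOfOrthogonalEqBot orthonormal_sinVec
  (orthogonal_span_range_eq_bot fun _ => eq_zero_of_inner_sinVec_eq_zero)

/-- The Hilbert basis of cosines. -/
def cosBasis : HilbertBasis ℕ ℝ L2 := HilbertBasis.mkOfOrthogonalEqBot orthonormal_cosVec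
  (orthogonal_span_range_eq_bot fun _ => eq_zero_of_inner_cosVec_eq_zero)

@[simp] theorem coe_sinBasis : ⇑sinBasis = sinVec := HilbertBasis.coe_mkOfOrthogonalEqBot _ _

@[simp] theorem coe_cosBasis : ⇑cosBasis = cosVec := HilbertBasis.coe_mkOfOrthogonalEqBot _ _

/-! ### Test functions in `H¹₀(0,1)` -/

theorem intervalIntegrable_coeFn (g : L2) : IntervalIntegrable g volume 0 1 :=
  (intervalIntegrable_iff_integrableOn_Ioo_of_le zero_le_one).2 (integrable_coeFn g)

/-- The class of the indicator function of `(0,x)`. -/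
def indicatorVec (x : ℝ) : L2 :=
  indicatorConstLp 2 (measurableSet_Ioo (a := 0) (b := x)) (measure_ne_top _ _) (1 : ℝ)

theorem inner_indicatorVec {x : ℝ} (hx : x ∈ Icc (0 : ℝ) 1) (g : L2) :
    inner ℝ (indicatorVec x) g = ∫ y in (0 : ℝ)..x, g y := by
  rw [indicatorVec, L2.inner_indicatorConstLp_one, Measure.restrict_restrict measurableSet_Ioo,
    inter_eq_left.2 (Ioo_subset_Ioo_right hx.2), intervalIntegral.integral_of_le hx.1,
    integral_Ioc_eq_integral_Ioo]

theorem integral_toL2 {φ : ℝ → ℝ} (hφ : Continuous φ) {x : ℝ} (hx : x ∈ Icc (0 : ℝ) 1) :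
    ∫ y in (0 : ℝ)..x, toL2 φ hφ y = ∫ y in (0 : ℝ)..x, φ y := by
  rw [intervalIntegral.integral_of_le hx.1, intervalIntegral.integral_of_le hx.1,
    integral_Ioc_eq_integral_Ioo, integral_Ioc_eq_integral_Ioo]
  exact integral_congr_ae
    (ae_restrict_of_ae_restrict_of_subset (Ioo_subset_Ioo_right hx.2) (coeFn_toL2 hφ))

theorem inner_cosVec_zero (g : L2) : inner ℝ (cosVec 0) g = ∫ y in (0 : ℝ)..1, g y := by
  rw [cosVec, inner_toL2, intervalIntegral.integral_of_le zero_le_one,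
    integral_Ioc_eq_integral_Ioo]
  simp

theorem isH10_sinMode (k : ℕ) : IsH10 (sinMode k) (freq k • cosVec (k + 1)) := by
  refine ⟨fun x hx => ?_, sinMode_one k⟩
  rw [← inner_indicatorVec hx, inner_smul_right, inner_indicatorVec hx, cosVec, integral_toL2 _ hx,
    integral_cosMode, mul_div_cancel₀ _ (freq_pos k).ne']

theorem isH10_primitive {g : L2} (hg : inner ℝ (cosVec 0) g = 0) :
    IsH10 (fun x => ∫ y in (0 : ℝ)..x, g y) g :=
  ⟨fun _ _ => rfl, by rw [← inner_cosVec_zero, hg]⟩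

namespace IsH10

variable {φ : ℝ → ℝ} {g : L2}

theorem inner_cosVec_zero (h : IsH10 φ g) : inner ℝ (cosVec 0) g = 0 := by
  rw [HeatControl.inner_cosVec_zero, ← h.eq_integral 1 (by simp), h.at_one]

theorem continuousOn (h : IsH10 φ g) : ContinuousOn φ (Icc 0 1) := by
  have := ((intervalIntegrable_coeFn g).absolutelyContinuousOnInterval_intervalIntegral
    (c := 0) (by simp)).continuousOn
  rw [uIcc_of_le zero_le_one] at this
  exact this.congr h.eq_integral

theorem memLp (h : IsH10 φ g) : MemLp φ 2 (volume.restrict (Ioo (0 : ℝ) 1)) :=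
  memLp_of_continuousOn h.continuousOn 2

theorem inner_toLp (h : IsH10 φ g) (f : L2) :
    inner ℝ f (h.memLp.toLp φ) = ∫ x in Ioo (0 : ℝ) 1, f x * φ x := by
  rw [inner_eq_integral]
  refine integral_congr_ae ?_
  filter_upwards [h.memLp.coeFn_toLp] with x hx
  rw [hx]

/-- Integration by parts; the boundary terms vanish because `φ` is zero at both ends. -/
theorem inner_cosVec_succ (h : IsH10 φ g) (k : ℕ) :
    inner ℝ (cosVec (k + 1)) g = freq k * inner ℝ (sinVec k) (h.memLp.toLp φ) := by
  have h0 : φ 0 = 0 := by rw [h.eq_integral 0 (by simp)]; simp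
  have hφi : IntervalIntegrable φ volume 0 1 :=
    ContinuousOn.intervalIntegrable (by rw [uIcc_of_le zero_le_one]; exact h.continuousOn)
  have key := integral_mul_add_mul_of_primitive (a := 0) (b := 1) (F := φ) (f := g)
    (G := cosMode k) (g := fun x => -(freq k * sinMode k x))
    (intervalIntegrable_coeFn g) (Continuous.intervalIntegrable (by fun_prop) _ _)
    (fun x hx => by
      rw [uIcc_of_le zero_le_one] at hx
      rw [h0, zero_add, h.eq_integral x hx])
    (fun x _ => eq_add_integral_of_hasDerivAt (hasDerivAt_cosMode k) (by fun_prop) _ _)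
  rw [intervalIntegral.integral_add
      ((intervalIntegrable_coeFn g).mul_continuousOn (by fun_prop))
      (hφi.mul_continuousOn (by fun_prop)), h.at_one, h0] at key
  simp only [mul_neg, mul_left_comm _ (freq k), intervalIntegral.integral_neg,
    intervalIntegral.integral_const_mul, zero_mul, sub_zero] at key
  rw [cosVec, inner_toL2, sinVec, inner_toL2, ← integral_Ioc_eq_integral_Ioo,
    ← intervalIntegral.integral_of_le zero_le_one]
  have e : ∫ x in Ioo (0 : ℝ) 1, h.memLp.toLp φ x * sinMode k x =
      ∫ x in (0 : ℝ)..1, φ x * sinMode k x := by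
    rw [intervalIntegral.integral_of_le zero_le_one, integral_Ioc_eq_integral_Ioo]
    refine integral_congr_ae ?_
    filter_upwards [h.memLp.coeFn_toLp] with x hx
    rw [hx]
  rw [e]
  linarith

theorem hasSum_inner (h : IsH10 φ g) (f : L2) :
    HasSum (fun k => inner ℝ f (cosVec (k + 1)) *
      (freq k * inner ℝ (sinVec k) (h.memLp.toLp φ))) (inner ℝ f g) := by
  have := cosBasis.hasSum_inner_mul_inner f g
  simp only [coe_cosBasis] at this
  rw [← hasSum_nat_add_iff' 1] at this
  simpa [h.inner_cosVec_succ, h.inner_cosVec_zero] using this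

/-- Evaluation at `x` is the pairing of the derivative with the indicator of `(0,x)`, so Parseval in
the cosine basis gives pointwise convergence of the sine series. This is how the Dirac mass is
expanded in modes. -/
theorem hasSum_apply (h : IsH10 φ g) {x : ℝ} (hx : x ∈ Icc (0 : ℝ) 1) :
    HasSum (fun k => sinMode k x * inner ℝ (sinVec k) (h.memLp.toLp φ)) (φ x) := by
  have := h.hasSum_inner (indicatorVec x)
  rw [inner_indicatorVec hx, ← h.eq_integral x hx] at this
  refine this.congr_fun fun k => ?_
  rw [inner_indicatorVec hx, cosVec, integral_toL2 _ hx, integral_cosMode, ← mul_assoc,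
    div_mul_cancel₀ _ (freq_pos k).ne']

end IsH10

/-! ### Series in a Hilbert basis with variable coefficients -/

section series

variable {E : Type*} [NormedAddCommGroup E] [InnerProductSpace ℝ E] (b : HilbertBasis ℕ ℝ E)

theorem hasSum_smul_of_summable_sq {c : ℕ → ℝ} (hc : Summable fun k => c k ^ 2) :
    HasSum (fun k => c k • b k) (∑' k, c k • b k) := by
  have hm : Memℓp c 2 := memℓp_gen (by simpa using hc)
  have := b.hasSum_repr_symm ⟨c, hm⟩
  exact this.summable.hasSum

theorem inner_tsum_smul {c : ℕ → ℝ} (hc : Summable fun k => c k ^ 2) (k : ℕ) :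
    inner ℝ (b k) (∑' k, c k • b k) = c k := by
  have hm : Memℓp c 2 := memℓp_gen (by simpa using hc)
  have := b.hasSum_repr_symm ⟨c, hm⟩
  rw [show (∑' k, c k • b k) = b.repr.symm ⟨c, hm⟩ from this.tsum_eq, ← b.repr_apply_apply]
  simp

theorem norm_sq_tsum_smul {c : ℕ → ℝ} (hc : Summable fun k => c k ^ 2) :
    ‖∑' k, c k • b k‖ ^ 2 = ∑' k, c k ^ 2 := by
  rw [← real_inner_self_eq_norm_sq, ← b.tsum_inner_mul_inner]
  refine tsum_congr fun k => ?_
  rw [real_inner_comm, inner_tsum_smul b hc, sq]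

theorem summable_inner_sq (x : E) : Summable fun k => inner ℝ (b k) x ^ 2 := by
  refine (b.summable_inner_mul_inner x x).congr fun k => ?_
  rw [real_inner_comm, sq]

/-- By Parseval the squared distance between two values is the sum of `(c k t - c k r) ^ 2`, which
tends to zero by dominated convergence for series. -/
theorem continuousOn_tsum_smul {c : ℕ → ℝ → ℝ} {S : Set ℝ} {M : ℕ → ℝ}
    (hc : ∀ k, ContinuousOn (c k) S) (hM : Summable M) (hcM : ∀ k, ∀ t ∈ S, c k t ^ 2 ≤ M k) :
    ContinuousOn (fun t => ∑' k, c k t • b k) S := by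
  have hs : ∀ t ∈ S, Summable fun k => c k t ^ 2 := fun t ht =>
    hM.of_nonneg_of_le (fun _ => sq_nonneg _) fun k => hcM k t ht
  have hdiff : ∀ k, ∀ t ∈ S, ∀ r ∈ S, (c k t - c k r) ^ 2 ≤ 4 * M k := fun k t ht r hr => by
    nlinarith [hcM k t ht, hcM k r hr, sq_nonneg (c k t + c k r)]
  intro r hr
  rw [ContinuousWithinAt, tendsto_iff_norm_sub_tendsto_zero]
  have hlim : Tendsto (fun t => ∑' k, (c k t - c k r) ^ 2) (𝓝[S] r)
      (𝓝 (∑' _ : ℕ, (0 : ℝ))) := by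
    refine tendsto_tsum_of_dominated_convergence (hM.mul_left 4) (fun k => ?_) ?_
    · have : Tendsto (fun t => (c k t - c k r) ^ 2) (𝓝[S] r) (𝓝 ((c k r - c k r) ^ 2)) :=
        ((hc k r hr).tendsto.sub_const _).pow 2
      simpa using this
    · filter_upwards [self_mem_nhdsWithin] with t ht k
      rw [Real.norm_of_nonneg (sq_nonneg _)]
      exact hdiff k t ht r hr
  rw [tsum_zero] at hlim
  have hsqrt := (Real.continuous_sqrt.tendsto 0).comp hlim
  rw [Real.sqrt_zero] at hsqrt
  refine hsqrt.congr' ?_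
  filter_upwards [self_mem_nhdsWithin] with t ht
  have hsum : Summable fun k => (c k t - c k r) ^ 2 :=
    (hM.mul_left 4).of_nonneg_of_le (fun _ => sq_nonneg _) fun k => hdiff k t ht r hr
  rw [Function.comp_apply, ← norm_sq_tsum_smul b hsum, Real.sqrt_sq (norm_nonneg _)]
  simp only [sub_smul]
  rw [(hasSum_smul_of_summable_sq b (hs t ht)).summable.tsum_sub
    (hasSum_smul_of_summable_sq b (hs r hr)).summable]

/-- Tonelli exchanges sum and integral, and a function with finite integral is finite a.e. -/
theorem ae_summable_sq {α : Type*} [MeasurableSpace α] {μ : Measure α} {c : ℕ → α → ℝ}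
    (hc : ∀ k, MemLp (c k) 2 μ) (hs : Summable fun k => ∫ t, c k t ^ 2 ∂μ) :
    (∫⁻ t, ∑' k, ENNReal.ofReal (c k t ^ 2) ∂μ) ≠ ∞ ∧ ∀ᵐ t ∂μ, Summable fun k => c k t ^ 2 := by
  have hm : ∀ k, AEMeasurable (fun t => ENNReal.ofReal (c k t ^ 2)) μ := fun k =>
    ((hc k).aestronglyMeasurable.aemeasurable.pow_const 2).ennreal_ofReal
  have hfin : (∫⁻ t, ∑' k, ENNReal.ofReal (c k t ^ 2) ∂μ) ≠ ∞ := by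
    rw [lintegral_tsum hm]
    simp only [← ofReal_integral_eq_lintegral_ofReal (hc _).integrable_sq
      (Eventually.of_forall fun _ => sq_nonneg _)]
    exact hs.tsum_ofReal_ne_top
  refine ⟨hfin, ?_⟩
  filter_upwards [ae_lt_top' (AEMeasurable.tsum hm) hfin] with t ht
  have := ENNReal.summable_toReal ht.ne
  simpa [ENNReal.toReal_ofReal (sq_nonneg _)] using this

theorem memLp_tsum_smul {α : Type*} [MeasurableSpace α] {μ : Measure α} {c : ℕ → α → ℝ}
    (hc : ∀ k, MemLp (c k) 2 μ) (hs : Summable fun k => ∫ t, c k t ^ 2 ∂μ) :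
    MemLp (fun t => ∑' k, c k t • b k) 2 μ := by
  obtain ⟨hfin, hae⟩ := ae_summable_sq hc hs
  have hmeas : AEStronglyMeasurable (fun t => ∑' k, c k t • b k) μ := by
    refine aestronglyMeasurable_of_tendsto_ae atTop
      (f := fun n t => ∑ k ∈ Finset.range n, c k t • b k) (fun n => ?_) ?_
    · exact Finset.aestronglyMeasurable_fun_sum _ fun k _ =>
        (hc k).aestronglyMeasurable.smul_const _
    · filter_upwards [hae] with t ht
      exact (hasSum_smul_of_summable_sq b ht).tendsto_sum_nat
  rw [memLp_two_iff_integrable_sq_norm hmeas]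
  refine ⟨hmeas.norm.pow 2, ?_⟩
  rw [HasFiniteIntegral]
  refine lt_of_le_of_lt (lintegral_mono_ae ?_) hfin.lt_top
  filter_upwards [hae] with t ht
  rw [norm_sq_tsum_smul b ht, Real.enorm_of_nonneg (tsum_nonneg fun _ => sq_nonneg _),
    ENNReal.ofReal_tsum_of_nonneg (fun _ => sq_nonneg _) ht]

end series

/-! ### Fourier coefficients of solutions -/

/-- The sine coefficients of a weak solution are given by Duhamel's formula. -/
theorem IsHeatSolution.inner_sinVec_eq_duhamel {T : ℝ} (hT : 0 ≤ T) {F : ℝ → (ℝ → ℝ) → ℝ} {u₀ : L2}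
    {u : ℝ → L2} (h : IsHeatSolution T F u₀ u) (k : ℕ)
    (hF : IntervalIntegrable (fun s => F s (sinMode k)) volume 0 T) :
    inner ℝ (sinVec k) (u T) =
      duhamel (freq k ^ 2) (inner ℝ (sinVec k) u₀) (fun s => F s (sinMode k)) T := by
  obtain ⟨w, -, hwu, hweak⟩ := h.weak
  refine eq_duhamel_of_integral_eq hT hF (y := fun t => inner ℝ (sinVec k) (u t))
    (continuousOn_const.inner h.continuousOn) fun t ht => ?_
  rw [← hweak _ _ (isH10_sinMode k) t ht, ← intervalIntegral.integral_const_mul, sinVec,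
    inner_toL2, inner_toL2, add_right_inj, intervalIntegral.integral_of_le ht.1,
    intervalIntegral.integral_of_le ht.1, integral_Ioc_eq_integral_Ioo,
    integral_Ioc_eq_integral_Ioo]
  refine integral_congr_ae ?_
  filter_upwards [ae_restrict_of_ae_restrict_of_subset (Ioo_subset_Ioo_right ht.2) hwu]
    with s ⟨v, hv, huv⟩
  have e : u s = hv.memLp.toLp v := Lp.ext (huv.trans hv.memLp.coeFn_toLp.symm)
  -- One factor `freq k` comes from the derivative of the test function, the other from integrating
  -- by parts in `u s`.
  rw [← inner_eq_integral, inner_smul_right, real_inner_comm (cosVec (k + 1)), hv.inner_cosVec_succ, e,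
    sinVec]
  ring

/-! ### The solution with a point source -/

section pointSource

variable {T : ℝ}

theorem intervalIntegrable_coeFn_time (hT : 0 ≤ T) (ψ : L2Time T) :
    IntervalIntegrable ψ volume 0 T :=
  (intervalIntegrable_iff_integrableOn_Ioo_of_le hT).2 ((Lp.memLp ψ).integrable (by norm_num))

theorem intervalIntegrable_coeFn_sq_time (hT : 0 ≤ T) (ψ : L2Time T) :
    IntervalIntegrable (fun s => ψ s ^ 2) volume 0 T :=
  (intervalIntegrable_iff_integrableOn_Ioo_of_le hT).2 (Lp.memLp ψ).integrable_sq

/-- The sine coefficients of the solution with a point source. -/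
def pointCoeff (x₀ : ℝ) (ψ : L2Time T) (u₀ : L2) (k : ℕ) : ℝ → ℝ :=
  duhamel (freq k ^ 2) (inner ℝ (sinVec k) u₀) (fun s => ψ s * sinMode k x₀)

variable (x₀ : ℝ) (ψ : L2Time T) (u₀ : L2)

theorem continuousOn_pointCoeff (hT : 0 ≤ T) (k : ℕ) :
    ContinuousOn (pointCoeff x₀ ψ u₀ k) (Icc 0 T) :=
  continuousOn_duhamel hT ((intervalIntegrable_coeFn_time hT ψ).mul_const _)

theorem pointCoeff_energy_le (hT : 0 ≤ T) (k : ℕ) {t : ℝ} (ht : t ∈ Icc 0 T) :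
    pointCoeff x₀ ψ u₀ k t ^ 2 +
        freq k ^ 2 * (∫ s in (0 : ℝ)..t, pointCoeff x₀ ψ u₀ k s ^ 2) ≤
      inner ℝ (sinVec k) u₀ ^ 2 + 2 * (∫ s in (0 : ℝ)..T, ψ s ^ 2) * (1 / freq k ^ 2) := by
  have hi2 := intervalIntegrable_coeFn_sq_time hT ψ
  have e : ∀ s, (ψ s * sinMode k x₀) ^ 2 = sinMode k x₀ ^ 2 * ψ s ^ 2 := fun s => by ring
  refine (duhamel_energy_le (pow_pos (freq_pos k) 2)
    ((intervalIntegrable_coeFn_time hT ψ).mul_const _)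
    (by simp only [e]; exact hi2.const_mul _) ht).trans ?_
  simp only [e]
  rw [intervalIntegral.integral_const_mul, div_eq_mul_one_div]
  have h0 : 0 ≤ ∫ s in (0 : ℝ)..T, ψ s ^ 2 :=
    intervalIntegral.integral_nonneg hT fun _ _ => sq_nonneg _
  have h2 : sinMode k x₀ ^ 2 ≤ 2 := by
    have := pow_le_pow_left₀ (abs_nonneg _) (abs_sinMode_le k x₀) 2
    rwa [sq_abs, Real.sq_sqrt zero_le_two] at this
  gcongr

theorem summable_one_div_freq_sq : Summable fun k => 1 / freq k ^ 2 := by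
  have h := (summable_nat_add_iff 1).2 (Real.summable_one_div_nat_pow.2 one_lt_two)
  refine (h.mul_left (1 / Real.pi ^ 2)).congr fun k => ?_
  simp only [freq, mul_pow]
  push_cast
  field_simp

theorem summable_pointCoeff_bound :
    Summable fun k => inner ℝ (sinVec k) u₀ ^ 2 +
      2 * (∫ s in (0 : ℝ)..T, ψ s ^ 2) * (1 / freq k ^ 2) := by
  have h := summable_inner_sq sinBasis u₀
  simp only [coe_sinBasis] at h
  exact h.add (summable_one_div_freq_sq.mul_left _)

theorem pointCoeff_sq_le (hT : 0 ≤ T) (k : ℕ) {t : ℝ} (ht : t ∈ Icc 0 T) :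
    pointCoeff x₀ ψ u₀ k t ^ 2 ≤
      inner ℝ (sinVec k) u₀ ^ 2 + 2 * (∫ s in (0 : ℝ)..T, ψ s ^ 2) * (1 / freq k ^ 2) := by
  have h1 := pointCoeff_energy_le x₀ ψ u₀ hT k ht
  have h2 : 0 ≤ ∫ s in (0 : ℝ)..t, pointCoeff x₀ ψ u₀ k s ^ 2 :=
    intervalIntegral.integral_nonneg ht.1 fun _ _ => sq_nonneg _
  have := mul_nonneg (sq_nonneg (freq k)) h2
  linarith

theorem summable_pointCoeff_sq (hT : 0 ≤ T) {t : ℝ} (ht : t ∈ Icc 0 T) :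
    Summable fun k => pointCoeff x₀ ψ u₀ k t ^ 2 :=
  (summable_pointCoeff_bound ψ u₀).of_nonneg_of_le (fun _ => sq_nonneg _)
    fun k => pointCoeff_sq_le x₀ ψ u₀ hT k ht

/-- The solution with a point source. -/
def pointSolution (t : ℝ) : L2 := ∑' k, pointCoeff x₀ ψ u₀ k t • sinBasis k

theorem inner_sinVec_pointSolution (hT : 0 ≤ T) {t : ℝ} (ht : t ∈ Icc 0 T) (k : ℕ) :
    inner ℝ (sinVec k) (pointSolution x₀ ψ u₀ t) = pointCoeff x₀ ψ u₀ k t := by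
  have := inner_tsum_smul sinBasis (summable_pointCoeff_sq x₀ ψ u₀ hT ht) k
  rwa [congrFun coe_sinBasis k] at this

/-- The cosine coefficients of the derivative of the solution with a point source. -/
def pointDerivCoeff : ℕ → ℝ → ℝ
  | 0 => fun _ => 0
  | k + 1 => fun t => freq k * pointCoeff x₀ ψ u₀ k t

/-- The space derivative of the solution with a point source. -/
def pointDeriv (t : ℝ) : L2 := ∑' k, pointDerivCoeff x₀ ψ u₀ k t • cosBasis k

theorem memLp_pointDerivCoeff (hT : 0 ≤ T) (k : ℕ) :
    MemLp (pointDerivCoeff x₀ ψ u₀ k) 2 (volume.restrict (Ioo 0 T)) := by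
  refine memLp_of_continuousOn ?_ 2
  cases k with
  | zero => exact continuousOn_const
  | succ k => exact continuousOn_const.mul (continuousOn_pointCoeff x₀ ψ u₀ hT k)

/-- Each term of positive index is the dissipation in the energy estimate at time `T`, hence has a
summable bound. -/
theorem summable_integral_pointDerivCoeff_sq (hT : 0 ≤ T) :
    Summable fun k => ∫ t in Ioo (0 : ℝ) T, pointDerivCoeff x₀ ψ u₀ k t ^ 2 := by
  rw [← summable_nat_add_iff 1]
  refine (summable_pointCoeff_bound ψ u₀).of_nonneg_of_le
    (fun _ => integral_nonneg fun _ => sq_nonneg _) fun k => ?_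
  have h1 := pointCoeff_energy_le x₀ ψ u₀ hT k (t := T) (by simp [hT])
  simp only [pointDerivCoeff, mul_pow]
  rw [integral_const_mul, ← integral_Ioc_eq_integral_Ioo, ← intervalIntegral.integral_of_le hT]
  linarith [sq_nonneg (pointCoeff x₀ ψ u₀ k T)]

theorem memLp_pointDeriv (hT : 0 ≤ T) :
    MemLp (pointDeriv x₀ ψ u₀) 2 (volume.restrict (Ioo 0 T)) :=
  memLp_tsum_smul cosBasis (memLp_pointDerivCoeff x₀ ψ u₀ hT)
    (summable_integral_pointDerivCoeff_sq x₀ ψ u₀ hT)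

theorem ae_inner_cosVec_pointDeriv (hT : 0 ≤ T) :
    ∀ᵐ t ∂(volume.restrict (Ioo 0 T)), ∀ k,
      inner ℝ (cosVec k) (pointDeriv x₀ ψ u₀ t) = pointDerivCoeff x₀ ψ u₀ k t := by
  filter_upwards [(ae_summable_sq (memLp_pointDerivCoeff x₀ ψ u₀ hT)
    (summable_integral_pointDerivCoeff_sq x₀ ψ u₀ hT)).2] with t ht k
  have := inner_tsum_smul cosBasis ht k
  rwa [congrFun coe_cosBasis k] at this

theorem isHeatSolution_pointSolution (hT : 0 ≤ T) (hx₀ : x₀ ∈ Icc (0 : ℝ) 1) :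
    IsHeatSolution T (pointSource x₀ ψ) u₀ (pointSolution x₀ ψ u₀) where
  continuousOn := continuousOn_tsum_smul sinBasis (continuousOn_pointCoeff x₀ ψ u₀ hT)
    (summable_pointCoeff_bound ψ u₀) fun k _ ht => pointCoeff_sq_le x₀ ψ u₀ hT k ht
  initial := by
    rw [← sub_eq_zero]
    refine eq_zero_of_inner_sinVec_eq_zero fun k => ?_
    rw [inner_sub_right, inner_sinVec_pointSolution x₀ ψ u₀ hT (by simp [hT]), pointCoeff,
      duhamel_zero, sub_self]
  weak := by
    have hw := memLp_pointDeriv x₀ ψ u₀ hT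
    refine ⟨pointDeriv x₀ ψ u₀, hw, ?_, ?_⟩
    · filter_upwards [ae_inner_cosVec_pointDeriv x₀ ψ u₀ hT,
        ae_restrict_mem measurableSet_Ioo] with t ht htT
      -- The primitive of the cosine series vanishes at `1` because its constant mode is zero; it is
      -- the `H¹₀` representative of the state.
      have hv := isH10_primitive (ht 0)
      refine ⟨_, hv, ?_⟩
      have e : pointSolution x₀ ψ u₀ t = hv.memLp.toLp _ := by
        rw [← sub_eq_zero]
        refine eq_zero_of_inner_sinVec_eq_zero fun k => ?_
        have h1 := hv.inner_cosVec_succ k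
        rw [ht (k + 1)] at h1
        have h2 := mul_left_cancel₀ (freq_pos k).ne' h1
        rw [inner_sub_right, inner_sinVec_pointSolution x₀ ψ u₀ hT
          (Ioo_subset_Icc_self htT), h2, sub_self]
      rw [e]
      exact hv.memLp.coeFn_toLp
    · intro φ g h t ht
      have hwi : IntervalIntegrable (pointDeriv x₀ ψ u₀) volume 0 t := by
        rw [intervalIntegrable_iff_integrableOn_Ioo_of_le ht.1]
        exact (IntegrableOn.mono_set (hw.integrable (by norm_num) :
          IntegrableOn (pointDeriv x₀ ψ u₀) (Ioo 0 T) volume) (Ioo_subset_Ioo_right ht.2))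
      -- Integrating the derivative in time first, as an `L²(0,1)`-valued integral, turns the weak
      -- identity into one between inner products that can be expanded in modes.
      set W : L2 := ∫ s in (0 : ℝ)..t, pointDeriv x₀ ψ u₀ s with hW
      have hinner : ∀ f : L2, inner ℝ f W =
          ∫ s in (0 : ℝ)..t, inner ℝ f (pointDeriv x₀ ψ u₀ s) := fun f =>
        ((innerSL ℝ f).intervalIntegral_comp_comm hwi).symm
      have hWk : ∀ k, inner ℝ (cosVec (k + 1)) W =
          freq k * ∫ s in (0 : ℝ)..t, pointCoeff x₀ ψ u₀ k s := by
        intro k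
        rw [hinner, ← intervalIntegral.integral_const_mul, intervalIntegral.integral_of_le ht.1,
          intervalIntegral.integral_of_le ht.1, integral_Ioc_eq_integral_Ioo,
          integral_Ioc_eq_integral_Ioo]
        refine integral_congr_ae ?_
        filter_upwards [ae_restrict_of_ae_restrict_of_subset (Ioo_subset_Ioo_right ht.2)
          (ae_inner_cosVec_pointDeriv x₀ ψ u₀ hT)] with s hs
        exact hs (k + 1)
      have e1 : (∫ s in (0 : ℝ)..t, ∫ x in Ioo (0 : ℝ) 1, pointDeriv x₀ ψ u₀ s x * g x) =
          inner ℝ W g := by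
        rw [real_inner_comm, hinner]
        refine intervalIntegral.integral_congr fun s _ => ?_
        simp only [← inner_eq_integral]
        exact real_inner_comm _ _
      have e2 : (∫ s in (0 : ℝ)..t, pointSource x₀ ψ s φ) = (∫ s in (0 : ℝ)..t, ψ s) * φ x₀ := by
        simp only [pointSource]
        rw [intervalIntegral.integral_mul_const]
      rw [e1, e2, ← h.inner_toLp, ← h.inner_toLp, ← inner_sub_left]
      have s1 := sinBasis.hasSum_inner_mul_inner (pointSolution x₀ ψ u₀ t - u₀)
        (h.memLp.toLp φ)
      rw [coe_sinBasis] at s1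
      -- Both sides are now series over the modes, and they agree termwise: term `k` is the
      -- integrated scalar equation times the `k`-th sine coefficient of `φ`.
      refine (s1.add (h.hasSum_inner W)).unique ?_
      refine ((h.hasSum_apply hx₀).mul_left (∫ s in (0 : ℝ)..t, ψ s)).congr_fun fun k => ?_
      have hode := duhamel_integral_eq (l := freq k ^ 2) (α := inner ℝ (sinVec k) u₀)
        ((intervalIntegrable_coeFn_time hT ψ).mul_const (sinMode k x₀)) ht
      rw [intervalIntegral.integral_mul_const] at hode
      rw [real_inner_comm, real_inner_comm (cosVec (k + 1)), hWk, inner_sub_right,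
        inner_sinVec_pointSolution x₀ ψ u₀ hT ht]
      simp only [pointCoeff]
      linear_combination inner ℝ (sinVec k) (h.memLp.toLp φ) * hode

/-- The moment conditions on `ψ` imply that it is a pointwise null-control. -/
theorem isPointwiseNullControllable_of_duhamel_eq_zero (hT : 0 ≤ T) (hx₀ : x₀ ∈ Icc (0 : ℝ) 1)
    (h : ∀ k, duhamel (freq k ^ 2) (inner ℝ (sinVec k) u₀) (fun s => ψ s * sinMode k x₀) T = 0) :
    IsPointwiseNullControllable x₀ T u₀ :=
  ⟨ψ, pointSolution x₀ ψ u₀, isHeatSolution_pointSolution x₀ ψ u₀ hT hx₀,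
    eq_zero_of_inner_sinVec_eq_zero fun k => by
      rw [inner_sinVec_pointSolution x₀ ψ u₀ hT (by simp [hT])]; exact h k⟩

end pointSource

/-! ### Controls supported near a point -/

theorem restrict_cylinder_eq_prod (T : ℝ) :
    (volume.restrict (Ioo (0 : ℝ) T ×ˢ Ioo (0 : ℝ) 1) : Measure (ℝ × ℝ)) =
      (volume.restrict (Ioo (0 : ℝ) T)).prod (volume.restrict (Ioo (0 : ℝ) 1)) := by
  rw [Measure.prod_restrict]; rfl

theorem measurePreserving_fst_cylinder (T : ℝ) :
    MeasurePreserving Prod.fst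
      (volume.restrict (Ioo (0 : ℝ) T ×ˢ Ioo (0 : ℝ) 1) : Measure (ℝ × ℝ))
      (volume.restrict (Ioo (0 : ℝ) T)) := by
  have : IsProbabilityMeasure (volume.restrict (Ioo (0 : ℝ) 1)) := ⟨by simp⟩
  rw [restrict_cylinder_eq_prod]
  exact measurePreserving_fst

theorem integrable_prod_of_cylinder {T : ℝ} {G : ℝ × ℝ → ℝ}
    (hG : Integrable G (volume.restrict (Ioo (0 : ℝ) T ×ˢ Ioo (0 : ℝ) 1))) :
    Integrable G ((volume.restrict (Ioo (0 : ℝ) T)).prod (volume.restrict (Ioo (0 : ℝ) 1))) := by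
  rwa [restrict_cylinder_eq_prod] at hG

theorem integral_cylinder {T : ℝ} {G : ℝ × ℝ → ℝ}
    (hG : Integrable G (volume.restrict (Ioo (0 : ℝ) T ×ˢ Ioo (0 : ℝ) 1))) :
    ∫ p in Ioo (0 : ℝ) T ×ˢ Ioo (0 : ℝ) 1, G p =
      ∫ s in Ioo (0 : ℝ) T, ∫ x in Ioo (0 : ℝ) 1, G (s, x) := by
  rw [restrict_cylinder_eq_prod, integral_prod _ (integrable_prod_of_cylinder hG)]

section

variable {T : ℝ}

theorem memLp_mul_cylinder {h θ : ℝ → ℝ} (hh : MemLp h 2 (volume.restrict (Ioo (0 : ℝ) T)))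
    (hθ : Measurable θ) {C : ℝ} (hC : ∀ x ∈ Ioo (0 : ℝ) 1, |θ x| ≤ C) :
    MemLp (fun p : ℝ × ℝ => h p.1 * θ p.2) 2
      (volume.restrict (Ioo (0 : ℝ) T ×ˢ Ioo (0 : ℝ) 1)) := by
  have hh' := hh.comp_measurePreserving (measurePreserving_fst_cylinder T)
  refine hh'.of_le_mul (c := C) (hh'.1.mul (hθ.comp measurable_snd).aestronglyMeasurable) ?_
  filter_upwards [ae_restrict_mem (measurableSet_Ioo.prod measurableSet_Ioo)] with p hp
  rw [norm_mul, mul_comm]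
  exact mul_le_mul_of_nonneg_right (hC _ hp.2) (norm_nonneg _)

/-- A control supported in a strip of width `2 ε` pairs with `h(t) θ(x)` with a gain `ε ^ (1/2)`. -/
theorem abs_integral_cylinder_le {x₀ ε : ℝ} (hε : 0 ≤ ε) {f : L2Cyl T}
    (hf : ∀ᵐ p ∂(volume.restrict (Ioo (0 : ℝ) T ×ˢ Ioo (0 : ℝ) 1)),
      p.2 ∉ Ioo (x₀ - ε) (x₀ + ε) → f p = 0)
    (h : L2Time T) {θ : ℝ → ℝ} (hθ : Continuous θ) {C : ℝ} (hC0 : 0 ≤ C)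
    (hC : ∀ x ∈ Ioo (x₀ - ε) (x₀ + ε), |θ x| ≤ C) :
    |∫ p in Ioo (0 : ℝ) T ×ˢ Ioo (0 : ℝ) 1, f p * (h p.1 * θ p.2)| ≤
      ‖f‖ * (C * √(2 * ε) * ‖h‖) := by
  -- Cutting `θ` off outside the strip leaves the pairing with `f` unchanged and makes its `L²` norm
  -- at most `C √(2ε)`.
  set χ : ℝ → ℝ := (Ioo (x₀ - ε) (x₀ + ε)).indicator θ with hχ
  have hχm : Measurable χ := hθ.measurable.indicator measurableSet_Ioo
  have hχC : ∀ x, |χ x| ≤ C := by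
    intro x
    by_cases hx : x ∈ Ioo (x₀ - ε) (x₀ + ε)
    · rw [hχ, indicator_of_mem hx]; exact hC x hx
    · rw [hχ, indicator_of_notMem hx, abs_zero]; exact hC0
  have hK := memLp_mul_cylinder (Lp.memLp h) hχm fun x _ => hχC x
  have e1 : ∫ p in Ioo (0 : ℝ) T ×ˢ Ioo (0 : ℝ) 1, f p * (h p.1 * θ p.2) =
      inner ℝ f (hK.toLp _) := by
    rw [inner_eq_integral]
    refine integral_congr_ae ?_
    filter_upwards [hf, hK.coeFn_toLp] with p hp hp'
    rw [hp']
    by_cases hx : p.2 ∈ Ioo (x₀ - ε) (x₀ + ε)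
    · simp only [hχ]; rw [indicator_of_mem hx]
    · rw [hp hx]; simp
  have e2 : ‖hK.toLp _‖ ^ 2 = ‖h‖ ^ 2 * ∫ x in Ioo (0 : ℝ) 1, χ x ^ 2 := by
    rw [← real_inner_self_eq_norm_sq, ← real_inner_self_eq_norm_sq, inner_eq_integral,
      inner_eq_integral, ← integral_prod_mul, ← restrict_cylinder_eq_prod]
    refine integral_congr_ae ?_
    filter_upwards [hK.coeFn_toLp] with p hp
    rw [hp]; ring
  have e3 : ∫ x in Ioo (0 : ℝ) 1, χ x ^ 2 ≤ C ^ 2 * (2 * ε) := by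
    calc ∫ x in Ioo (0 : ℝ) 1, χ x ^ 2
        ≤ ∫ x in Ioo (0 : ℝ) 1, (Ioo (x₀ - ε) (x₀ + ε)).indicator (fun _ => C ^ 2) x := by
          refine integral_mono_of_nonneg (Eventually.of_forall fun _ => sq_nonneg _)
            ((integrable_const _).indicator measurableSet_Ioo)
            (Eventually.of_forall fun x => ?_)
          by_cases hx : x ∈ Ioo (x₀ - ε) (x₀ + ε)
          · simp only [indicator_of_mem hx]
            rw [← sq_abs]
            exact pow_le_pow_left₀ (abs_nonneg _) (hχC x) 2
          · simp only [hχ, indicator_of_notMem hx]; simp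
      _ = C ^ 2 * (volume.restrict (Ioo (0 : ℝ) 1)).real (Ioo (x₀ - ε) (x₀ + ε)) := by
          rw [integral_indicator measurableSet_Ioo, setIntegral_const, smul_eq_mul, mul_comm]
      _ ≤ C ^ 2 * volume.real (Ioo (x₀ - ε) (x₀ + ε)) := by
          refine mul_le_mul_of_nonneg_left ?_ (sq_nonneg C)
          exact ENNReal.toReal_mono (by simp) (Measure.restrict_apply_le _ _)
      _ = C ^ 2 * (2 * ε) := by
          rw [Real.volume_real_Ioo_of_le (by linarith)]; ring
  rw [e1]
  refine (abs_real_inner_le_norm _ _).trans ?_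
  gcongr
  refine le_of_sq_le_sq ?_ (by positivity)
  rw [e2, mul_pow, mul_pow, Real.sq_sqrt (by positivity), mul_comm]
  gcongr

/-- The functional `h ↦ ∬ f(t,x) h(t)` on `L²(0,T)`. -/
def timeFunctional (f : L2Cyl T) : StrongDual ℝ (L2Time T) :=
  (innerSL ℝ f).comp (Lp.compMeasurePreservingₗᵢ ℝ Prod.fst
    (measurePreserving_fst_cylinder T)).toContinuousLinearMap

theorem timeFunctional_apply (f : L2Cyl T) (h : L2Time T) :
    timeFunctional f h = ∫ p in Ioo (0 : ℝ) T ×ˢ Ioo (0 : ℝ) 1, f p * h p.1 := by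
  change inner ℝ f (Lp.compMeasurePreserving Prod.fst (measurePreserving_fst_cylinder T) h) = _
  rw [inner_eq_integral]
  refine integral_congr_ae ?_
  filter_upwards [Lp.coeFn_compMeasurePreserving h (measurePreserving_fst_cylinder T)] with p hp
  rw [hp, Function.comp_apply]

/-- The strip estimate with `θ = 1`; this is the origin of the rate `ε ^ (1/2)` in the theorem. -/
theorem norm_timeFunctional_le {x₀ ε : ℝ} (hε : 0 ≤ ε) {f : L2Cyl T}
    (hf : ∀ᵐ p ∂(volume.restrict (Ioo (0 : ℝ) T ×ˢ Ioo (0 : ℝ) 1)),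
      p.2 ∉ Ioo (x₀ - ε) (x₀ + ε) → f p = 0) :
    ‖timeFunctional f‖ ≤ √(2 * ε) * ‖f‖ := by
  refine ContinuousLinearMap.opNorm_le_bound _ (by positivity) fun h => ?_
  have := abs_integral_cylinder_le hε hf h (θ := fun _ => 1) continuous_const zero_le_one
    (by simp)
  simp only [mul_one] at this
  rw [timeFunctional_apply, Real.norm_eq_abs]
  linarith

/-- The class in `L²(0,T)` of `s ↦ exp (l s)`. -/
def expVec (T l : ℝ) : L2Time T :=
  (memLp_of_continuousOn (φ := fun s => Real.exp (l * s)) (by fun_prop) 2).toLp _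

theorem coeFn_expVec (l : ℝ) :
    expVec T l =ᵐ[volume.restrict (Ioo (0 : ℝ) T)] fun s => Real.exp (l * s) :=
  MemLp.coeFn_toLp _

theorem integrable_mul_cylinder (f : L2Cyl T) (h : L2Time T) {θ : ℝ → ℝ} (hθ : Continuous θ) :
    Integrable (fun p : ℝ × ℝ => f p * (h p.1 * θ p.2))
      (volume.restrict (Ioo (0 : ℝ) T ×ˢ Ioo (0 : ℝ) 1)) := by
  obtain ⟨C, hC⟩ := isCompact_Icc.exists_bound_of_continuousOn
    (hθ.continuousOn (s := Icc (0 : ℝ) 1))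
  exact (Lp.memLp f).integrable_mul (memLp_mul_cylinder (Lp.memLp h) hθ.measurable
    fun x hx => hC x (Ioo_subset_Icc_self hx))

theorem intervalIntegrable_internalSource (hT : 0 ≤ T) (f : L2Cyl T) {θ : ℝ → ℝ}
    (hθ : Continuous θ) : IntervalIntegrable (fun s => internalSource f s θ) volume 0 T := by
  rw [intervalIntegrable_iff_integrableOn_Ioo_of_le hT]
  obtain ⟨C, hC⟩ := isCompact_Icc.exists_bound_of_continuousOn
    (hθ.continuousOn (s := Icc (0 : ℝ) 1))
  have := (Lp.memLp f).integrable_mul (memLp_mul_cylinder (h := fun _ => 1) (memLp_const 1)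
    hθ.measurable fun x hx => hC x (Ioo_subset_Icc_self hx))
  simpa [internalSource, IntegrableOn] using (integrable_prod_of_cylinder this).integral_prod_left

/-- The moments of a null-control. -/
theorem IsNullControl.moment (hT : 0 ≤ T) {x₀ ε : ℝ} {u₀ : L2} {f : L2Cyl T}
    (hf : IsNullControl x₀ ε T u₀ f) (k : ℕ) :
    inner ℝ (sinVec k) u₀ + ∫ p in Ioo (0 : ℝ) T ×ˢ Ioo (0 : ℝ) 1,
      f p * (expVec T (freq k ^ 2) p.1 * sinMode k p.2) = 0 := by
  obtain ⟨-, u, hu, huT⟩ := hf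
  have h := hu.inner_sinVec_eq_duhamel hT k
    (intervalIntegrable_internalSource hT f (by fun_prop))
  rw [huT, inner_zero_right, duhamel, eq_comm] at h
  have h' := (mul_eq_zero.1 h).resolve_left (Real.exp_pos _).ne'
  refine Eq.trans (congrArg _ ?_) h'
  have hi := integrable_mul_cylinder f (expVec T (freq k ^ 2)) (continuous_sinMode k)
  rw [integral_cylinder hi, intervalIntegral.integral_of_le hT, integral_Ioc_eq_integral_Ioo]
  refine integral_congr_ae ?_
  filter_upwards [coeFn_expVec (freq k ^ 2)] with s hs
  simp only [hs, internalSource, mul_left_comm _ (Real.exp _)]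
  rw [integral_const_mul]

theorem abs_sinMode_sub_le (k : ℕ) (x y : ℝ) :
    |sinMode k x - sinMode k y| ≤ √2 * freq k * |x - y| := by
  have := Real.lipschitzWith_sin.dist_le_mul (freq k * x) (freq k * y)
  rw [Real.dist_eq, Real.dist_eq, NNReal.coe_one, one_mul, ← mul_sub, abs_mul (freq k),
    abs_of_pos (freq_pos k)] at this
  rw [sinMode, sinMode, ← mul_sub, abs_mul, abs_of_nonneg (Real.sqrt_nonneg _), mul_assoc]
  gcongr

/-- Approximate moments of the time functional of a null-control supported near `x₀`. -/
theorem IsNullControl.abs_moment_le (hT : 0 ≤ T) {x₀ ε : ℝ} (hε : 0 ≤ ε) {u₀ : L2} {f : L2Cyl T}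
    (hf : IsNullControl x₀ ε T u₀ f) (k : ℕ) :
    |inner ℝ (sinVec k) u₀ + timeFunctional f (expVec T (freq k ^ 2)) * sinMode k x₀| ≤
      ‖f‖ * (√2 * freq k * ε * √(2 * ε) * ‖expVec T (freq k ^ 2)‖) := by
  have hm := hf.moment hT k
  -- On the strip this `θ` is at most `√2 * freq k * ε`, which supplies the extra factor `ε`.
  have hb := abs_integral_cylinder_le hε hf.1 (expVec T (freq k ^ 2))
    (θ := fun x => sinMode k x - sinMode k x₀) (by fun_prop)
    (C := √2 * freq k * ε) (by have := freq_pos k; positivity) fun x hx => by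
      refine (abs_sinMode_sub_le k x x₀).trans ?_
      have := freq_pos k
      gcongr
      rw [abs_le]
      constructor <;> linarith [hx.1, hx.2]
  have hc := integrable_mul_cylinder f (expVec T (freq k ^ 2)) (θ := fun _ => sinMode k x₀)
    continuous_const
  have e : ∫ p in Ioo (0 : ℝ) T ×ˢ Ioo (0 : ℝ) 1,
      f p * (expVec T (freq k ^ 2) p.1 * (sinMode k p.2 - sinMode k x₀)) =
      (∫ p in Ioo (0 : ℝ) T ×ˢ Ioo (0 : ℝ) 1,
        f p * (expVec T (freq k ^ 2) p.1 * sinMode k p.2)) -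
      timeFunctional f (expVec T (freq k ^ 2)) * sinMode k x₀ := by
    rw [timeFunctional_apply, ← integral_mul_const, ← integral_sub
      (integrable_mul_cylinder f _ (continuous_sinMode k))
      (by simpa only [mul_assoc] using hc)]
    congr 1
    funext p
    ring
  rw [e, abs_sub_comm] at hb
  refine le_of_eq_of_le ?_ hb
  congr 1
  linarith

theorem inner_expVec (hT : 0 ≤ T) (ψ : L2Time T) (l : ℝ) :
    inner ℝ ψ (expVec T l) = ∫ s in (0 : ℝ)..T, Real.exp (l * s) * ψ s := by
  rw [inner_eq_integral, intervalIntegral.integral_of_le hT, integral_Ioc_eq_integral_Ioo]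
  refine integral_congr_ae ?_
  filter_upwards [coeFn_expVec l] with s hs
  rw [hs, mul_comm]

/-- If null-controls with shrinking control domains have norm `O(ε ^ (-1/2))` along some
ultrafilter, then the datum is pointwise null-controllable. -/
theorem isPointwiseNullControllable_of_ultrafilter (hT : 0 ≤ T) {x₀ : ℝ}
    (hx₀ : x₀ ∈ Icc (0 : ℝ) 1) {u₀ : L2} {f : ℝ → L2Cyl T} {M : ℝ} (U : Ultrafilter ℝ)
    (hU : (U : Filter ℝ) ≤ 𝓝[>] 0) (hf : ∀ᶠ ε in (U : Filter ℝ), IsNullControl x₀ ε T u₀ (f ε))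
    (hM : ∀ᶠ ε in (U : Filter ℝ), √ε * ‖f ε‖ ≤ M) : IsPointwiseNullControllable x₀ T u₀ := by
  have hpos : ∀ᶠ ε in (U : Filter ℝ), 0 < ε := hU self_mem_nhdsWithin
  have hbound : ∀ᶠ ε in (U : Filter ℝ), √(2 * ε) * ‖f ε‖ ≤ √2 * M := by
    filter_upwards [hM] with ε hε
    rw [Real.sqrt_mul zero_le_two, mul_assoc]
    gcongr
  -- Banach-Alaoglu: the functionals lie eventually in a fixed ball, so they converge weak-* along
  -- the ultrafilter, with no extraction of a subsequence.
  obtain ⟨Φ, -, hΦ⟩ := (WeakDual.isCompact_closedBall (0 : StrongDual ℝ (L2Time T))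
    (√2 * M)).ultrafilter_le_nhds (U.map fun ε => StrongDual.toWeakDual (timeFunctional (f ε))) (by
      rw [le_principal_iff, Ultrafilter.coe_map, mem_map]
      filter_upwards [hpos, hf, hbound] with ε h0 h1 h2
      simp only [mem_preimage, mem_closedBall_zero_iff]
      exact (norm_timeFunctional_le h0.le h1.1).trans h2)
  have hlim : ∀ h : L2Time T,
      Tendsto (fun ε => timeFunctional (f ε) h) (U : Filter ℝ) (𝓝 (Φ h)) := fun h =>
    ((WeakDual.eval_continuous h).tendsto Φ).comp hΦ
  set ψ : L2Time T := (InnerProductSpace.toDual ℝ (L2Time T)).symm (WeakDual.toStrongDual Φ)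
    with hψ
  refine isPointwiseNullControllable_of_duhamel_eq_zero x₀ ψ u₀ hT hx₀ fun k => ?_
  have hΦψ : ∀ h, inner ℝ ψ h = Φ h := fun h => InnerProductSpace.toDual_symm_apply
  have l1 := ((hlim (expVec T (freq k ^ 2))).mul_const (sinMode k x₀)).const_add
    (inner ℝ (sinVec k) u₀)
  have l2 : Tendsto (fun ε => inner ℝ (sinVec k) u₀ +
      timeFunctional (f ε) (expVec T (freq k ^ 2)) * sinMode k x₀) (U : Filter ℝ) (𝓝 0) := by
    have hz : Tendsto (fun ε : ℝ => √2 * freq k * ‖expVec T (freq k ^ 2)‖ * (√2 * M) * ε)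
        (U : Filter ℝ) (𝓝 0) := by
      have : Tendsto (fun ε : ℝ => ε) (U : Filter ℝ) (𝓝 0) :=
        hU.trans nhdsWithin_le_nhds
      simpa using this.const_mul (√2 * freq k * ‖expVec T (freq k ^ 2)‖ * (√2 * M))
    refine squeeze_zero_norm' ?_ hz
    filter_upwards [hpos, hf, hbound] with ε h0 h1 h2
    refine (h1.abs_moment_le hT h0.le k).trans ?_
    have hfr := freq_pos k
    calc ‖f ε‖ * (√2 * freq k * ε * √(2 * ε) * ‖expVec T (freq k ^ 2)‖)
        = √2 * freq k * ‖expVec T (freq k ^ 2)‖ * (√(2 * ε) * ‖f ε‖) * ε := by ring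
      _ ≤ _ := by gcongr
  -- The approximate moments converge both to the moment of the weak limit and to zero, so the limit
  -- moment equation is exact.
  have h0 := tendsto_nhds_unique l1 l2
  rw [← hΦψ, inner_expVec hT] at h0
  rw [duhamel]
  simp only [← mul_assoc]
  rw [intervalIntegral.integral_mul_const, h0, mul_zero]

end

end HeatControl

end

/-! ### Blow-up of the optimal controls -/

theorem theorem2 (x₀ : ℝ) (hx₀ : x₀ ∈ Set.Icc (0 : ℝ) 1) (T : ℝ) (hT : 0 < T)
    (hT₀ : ENNReal.ofReal T ≤ HeatControl.minimalTime x₀)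
    (u₀ : HeatControl.L2) (hu₀ : ¬ HeatControl.IsPointwiseNullControllable x₀ T u₀)
    (ψ : ℝ → HeatControl.L2Cyl T)
    (hψ : ∀ᶠ ε in 𝓝[>] (0 : ℝ), HeatControl.IsOptimalNullControl x₀ ε T u₀ (ψ ε)) :
    Tendsto (fun ε : ℝ => ε ^ (1 / 2 : ℝ) * ‖ψ ε‖) (𝓝[>] 0) atTop := by
  by_contra hnot
  obtain ⟨M, hM⟩ : ∃ M : ℝ, ∃ᶠ ε in 𝓝[>] (0 : ℝ), ε ^ (1 / 2 : ℝ) * ‖ψ ε‖ < M := by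
    simpa [tendsto_atTop] using hnot
  -- The bound `M` holds for arbitrarily small `ε`, so some ultrafilter converging to `0` from the
  -- right contains the set where it holds.
  have : (𝓝[>] (0 : ℝ) ⊓ 𝓟 {ε | ε ^ (1 / 2 : ℝ) * ‖ψ ε‖ < M}).NeBot :=
    frequently_mem_iff_neBot.1 hM
  obtain ⟨U, hU⟩ := Ultrafilter.exists_le (𝓝[>] (0 : ℝ) ⊓ 𝓟 {ε | ε ^ (1 / 2 : ℝ) * ‖ψ ε‖ < M})
  rw [le_inf_iff, le_principal_iff] at hU
  obtain ⟨hU, hUM⟩ := hU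
  refine hu₀ (HeatControl.isPointwiseNullControllable_of_ultrafilter hT.le hx₀ (M := M) U hU
    ((hψ.filter_mono hU).mono fun _ h => h.1) (mem_of_superset hUM fun ε h => ?_))
  rw [mem_ofPred_eq, Real.sqrt_eq_rpow]
  exact le_of_lt h
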